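/- Let $\mathbb{H}$ be the real quaternion algebra, let $n\ge 0$, and let $R=\mathbb{H}[x_1,\dots,x_n]$ be the ring of polynomials in $n$ central variables over $\mathbb{H}$: its elements are finite sums $\sum_m a_m x^m$ with $a_m\in\mathbb{H}$, $m=(m_1,\dots,m_n)\in\mathbb{Z}_{\ge 0}^n$, multiplied by $(a\,x^m)(b\,x^k)=ab\,x^{m+k}$. For $f=\sum_m a_m x^m\in R$ and an arbitrary point $q=(q_1,\dots,q_n)\in\mathbb{H}^n$ put $$f(q)=\sum_m a_m\, q_1^{m_1}q_2^{m_2}\cdots q_n^{m_n},$$ with the factors multiplied in this order. For a left ideal $I$ of $R$ let $\mathcal{V}(I)=\{q\in\mathbb{H}^n : f(q)=0 \text{ for all } f\in I\}$, and for a set $A\subseteq\mathbb{H}^n$ let $\mathcal{I}(A)=\{f\in R : f(q)=0\text{ for all } q\in A\}$. A proper left ideal $P$ of $R$ is called completely prime if for all $a,b\in R$ with $ab\in P$ and $Pb\subseteq P$ one has $a\in P$ or $b\in P$. The radical $\sqrt{I}$ is the intersection of all completely prime left ideals of $R$ that contain $I$ (and is $R$ if there are none). Then for every left ideal $I$ of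 $R$, $$\mathcal{I}(\mathcal{V}(I))=\sqrt{I}.$$ -/

import Mathlib

open scoped Quaternion

noncomputable section

/-- The ring `ℍ[x₁, …, xₙ]` of polynomials in `n` central variables over the real quaternions:
finite sums `∑ a_m x^m`, with `(a x^m) * (b x^k) = (a * b) x^(m + k)`. -/
abbrev QuatPoly (n : ℕ) : Type := AddMonoidAlgebra ℍ[ℝ] (Fin n →₀ ℕ)

namespace QuatPoly

/-- The value `∑ a_m * (q₁ ^ m₁ * q₂ ^ m₂ * ⋯ * qₙ ^ mₙ)` of `f = ∑ a_m x^m` at an arbitrary point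
`q = (q₁, …, qₙ)` of `ℍⁿ`; the powers are multiplied in the order of the indices. -/
def evalAt {n : ℕ} (q : Fin n → ℍ[ℝ]) (f : QuatPoly n) : ℍ[ℝ] :=
  f.coeff.sum fun m a => a * (List.ofFn fun u : Fin n => q u ^ m u).prod

/-- The set `𝒱(S)` of common zeros in `ℍⁿ` of a set `S` of polynomials. -/
def zeroLocus {n : ℕ} (S : Set (QuatPoly n)) : Set (Fin n → ℍ[ℝ]) :=
  {q | ∀ f ∈ S, evalAt q f = 0}

/-- The set `ℐ(A)` of polynomials that vanish on the set `A` of points of `ℍⁿ`. It is only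
a set: in general it need not be a left ideal. -/
def vanishingSet {n : ℕ} (A : Set (Fin n → ℍ[ℝ])) : Set (QuatPoly n) :=
  {f | ∀ q ∈ A, evalAt q f = 0}

end QuatPoly

/-- A left ideal `P` of a ring `A` (in Mathlib, `Ideal A` is the type of left ideals) is completely
prime if it is proper and, for all `a b : A` with `a * b ∈ P` and `P b ⊆ P`, one has `a ∈ P` or
`b ∈ P`. -/
def IsCompletelyPrimeLeft {A : Type*} [Ring A] (P : Ideal A) : Prop :=
  P ≠ ⊤ ∧ ∀ a b : A, a * b ∈ P → (∀ p ∈ P, p * b ∈ P) → a ∈ P ∨ b ∈ P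

/-- The radical `√I` of a left ideal: the intersection of all completely prime left ideals
that contain it (the whole ring if there are none). -/
def leftRadical {A : Type*} [Ring A] (I : Ideal A) : Ideal A :=
  sInf {P : Ideal A | IsCompletelyPrimeLeft P ∧ I ≤ P}

end

/-! The link between points and primes is the functional `twistedEval c z`, with `c ≠ 0` in ℍ and
`z` in ℂⁿ. Up to the right factor `c⁻¹` it is evaluation at the point `c z c⁻¹`, whose coordinates
commute, and its kernel is a completely prime left ideal.

Vanishing implies radical: let `P ⊇ I` be completely prime and `f ∉ P`. Real polynomials are
central, so `P` meets ℝ[x] in a prime `p` and `R/P` is torsion-free over ℝ[x]/p. As `R` is free of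
rank 4 over ℝ[x], a linear form separates `f` from `P` modulo `p`, and the Nullstellensatz gives a
complex zero of `p` where its value at `f` survives. The specialized form on ℂ⁴ is turned into a
quaternion `c`; at this zero or at its conjugate, the twisted evaluation kills `P` but not `f`
(`exists_twistedEval_ne_zero`).

Radical implies vanishing: `f` is killed by every twisted evaluation that kills `I`, but the
coordinates of `q ∈ 𝒱(I)` need not commute. They are replaced by complex numbers one at a time,
splitting the functional into eigenvectors when needed, until only twisted evaluations remain
(`pairing_mixedWeight_eq_zero`). -/

/-! ### Separation by linear forms and the Nullstellensatz -/

/-- If `N` is a submodule of `S ^ ι` whose quotient is torsion-free over `S ⧸ p`, a vector outside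
`N` is separated from `N` modulo `p` by a linear form. -/
theorem exists_linear_form_separating {S ι : Type*} [CommRing S] [Fintype ι] (p : Ideal S)
    [p.IsPrime] (N : AddSubgroup (ι → S)) (hsmul : ∀ (s : S), ∀ v ∈ N, s • v ∈ N)
    (hp : ∀ v : ι → S, (∀ i, v i ∈ p) → v ∈ N)
    (htf : ∀ (s : S) (v : ι → S), s • v ∈ N → s ∈ p ∨ v ∈ N) (v : ι → S) (hv : v ∉ N) :
    ∃ l : ι → S, (∀ u ∈ N, ∑ i, l i * u i ∈ p) ∧ ∑ i, l i * v i ∉ p := by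
  classical
  let D := S ⧸ p
  let K := FractionRing D
  let j : S →+* K := (algebraMap D K).comp (Ideal.Quotient.mk p)
  have hj : ∀ s, j s = 0 ↔ s ∈ p := fun s => by
    simp only [j, RingHom.comp_apply]
    rw [map_eq_zero_iff _ (IsFractionRing.injective D K), Ideal.Quotient.eq_zero_iff_mem]
  have hsurj : ∀ k : K, ∃ a b : S, b ∉ p ∧ k * j b = j a := by
    intro k
    obtain ⟨x, y, hy, rfl⟩ := IsFractionRing.div_surjective (A := D) k
    obtain ⟨a, rfl⟩ := Ideal.Quotient.mk_surjective x
    obtain ⟨b, rfl⟩ := Ideal.Quotient.mk_surjective y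
    have hb : b ∉ p := fun h => nonZeroDivisors.ne_zero hy (Ideal.Quotient.eq_zero_iff_mem.2 h)
    have hb' : j b ≠ 0 := fun h => hb ((hj b).1 h)
    exact ⟨a, b, hb, div_mul_cancel₀ _ hb'⟩
  let J : (ι → S) → (ι → K) := fun u i => j (u i)
  let W : Submodule K (ι → K) := Submodule.span K (J '' N)
  have hW : ∀ w ∈ W, ∃ s : S, s ∉ p ∧ ∃ u ∈ N, j s • w = J u := by
    intro w hw
    induction hw using Submodule.span_induction with
    | mem w hw =>
      obtain ⟨u, hu, rfl⟩ := hw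
      exact ⟨1, p.one_notMem, u, hu, by simp⟩
    | zero => exact ⟨1, p.one_notMem, 0, N.zero_mem, by ext; simp [J]⟩
    | add x y _ _ hx hy =>
      obtain ⟨s, hs, u, hu, hsu⟩ := hx
      obtain ⟨t, ht, u', hu', htu⟩ := hy
      refine ⟨s * t, fun h => (Ideal.IsPrime.mem_or_mem ‹_› h).elim hs ht, t • u + s • u',
        N.add_mem (hsmul _ _ hu) (hsmul _ _ hu'), ?_⟩
      ext i
      have h1 := congrFun hsu i
      have h2 := congrFun htu i
      simp only [Pi.smul_apply, smul_eq_mul, J, Pi.add_apply, map_add, map_mul] at h1 h2 ⊢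
      rw [← h1, ← h2]; ring
    | smul k x _ hx =>
      obtain ⟨s, hs, u, hu, hsu⟩ := hx
      obtain ⟨a, b, hb, hab⟩ := hsurj k
      refine ⟨s * b, fun h => (Ideal.IsPrime.mem_or_mem ‹_› h).elim hs hb, a • u,
        hsmul _ _ hu, ?_⟩
      ext i
      have h1 := congrFun hsu i
      simp only [Pi.smul_apply, smul_eq_mul, J, map_mul] at h1 ⊢
      rw [← h1, ← hab]; ring
  have hvW : J v ∉ W := by
    intro h
    obtain ⟨s, hs, u, hu, hsu⟩ := hW _ h
    have hd : s • v - u ∈ N := hp _ fun i => by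
      have h1 := congrFun hsu i
      simp only [Pi.smul_apply, smul_eq_mul, J] at h1
      rw [← hj]
      simp [h1]
    have := N.add_mem hd hu
    rw [sub_add_cancel] at this
    exact (htf s v this).elim hs hv
  obtain ⟨φ, hφv, hφ⟩ := Submodule.exists_le_ker_of_notMem hvW
  -- Clearing denominators of `φ` on the standard basis gives coefficients in `D`, which lift to
  -- `S`.
  obtain ⟨b, hb⟩ := IsLocalization.exist_integer_multiples_of_finite (nonZeroDivisors D)
    (fun i => φ (Pi.single i 1))
  choose d hd using hb
  choose l hl using fun i => Ideal.Quotient.mk_surjective (I := p) (d i)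
  have key : ∀ u : ι → S, j (∑ i, l i * u i) = algebraMap D K b * φ (J u) := by
    intro u
    have h1 : φ (J u) = ∑ i, j (u i) * φ (Pi.single i 1) := by
      conv_lhs => rw [pi_eq_sum_univ' (J u)]
      rw [map_sum]
      refine Finset.sum_congr rfl fun i _ => ?_
      rw [map_smul, smul_eq_mul]
    rw [h1, map_sum, Finset.mul_sum]
    refine Finset.sum_congr rfl fun i _ => ?_
    have h2 : j (l i) = algebraMap D K b * φ (Pi.single i 1) := by
      rw [← Algebra.smul_def]
      simp only [j, RingHom.comp_apply, hl]
      exact hd i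
    rw [map_mul, h2]; ring
  refine ⟨l, fun u hu => ?_, fun h => ?_⟩
  · rw [← hj, key, show φ (J u) = 0 from hφ (Submodule.subset_span ⟨u, hu, rfl⟩), mul_zero]
  · rw [← hj, key] at h
    rcases mul_eq_zero.1 h with h | h
    · exact nonZeroDivisors.ne_zero b.2 ((map_eq_zero_iff _ (IsFractionRing.injective D K)).1 h)
    · exact hφv h

/-- Over the reals, a prime ideal and a polynomial outside it are separated by a complex point. -/
theorem MvPolynomial.exists_complex_zero_of_notMem {n : ℕ} (p : Ideal (MvPolynomial (Fin n) ℝ))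
    [p.IsPrime] (d : MvPolynomial (Fin n) ℝ) (hd : d ∉ p) :
    ∃ z : Fin n → ℂ, (∀ s ∈ p, MvPolynomial.aeval z s = 0) ∧ MvPolynomial.aeval z d ≠ 0 := by
  by_contra! h
  refine hd ?_
  rw [← MvPolynomial.IsPrime.vanishingIdeal_zeroLocus (K := ℂ) p, MvPolynomial.mem_vanishingIdeal_iff]
  exact fun z hz => h z (MvPolynomial.mem_zeroLocus_iff.1 hz)

/-! ### Twisted evaluations and their kernels -/

namespace QuatPoly

variable {n : ℕ}

/-- The left `ℍ`-linear functional `∑ a_m x^m ↦ ∑ a_m * w m`. -/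
noncomputable def pairing (w : (Fin n →₀ ℕ) → ℍ[ℝ]) : QuatPoly n →+ ℍ[ℝ] where
  toFun f := f.coeff.sum fun m a => a * w m
  map_zero' := by simp
  map_add' f g := by
    rw [AddMonoidAlgebra.coeff_add]
    exact Finsupp.sum_add_index' (by simp) (by simp [add_mul])

theorem pairing_single (w : (Fin n →₀ ℕ) → ℍ[ℝ]) (m : Fin n →₀ ℕ) (a : ℍ[ℝ]) :
    pairing w (AddMonoidAlgebra.single m a) = a * w m := by
  change Finsupp.sum (Finsupp.single m a) (fun m a => a * w m) = _
  simp

theorem pairing_add (w w' : (Fin n →₀ ℕ) → ℍ[ℝ]) (f : QuatPoly n) :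
    pairing (fun m => w m + w' m) f = pairing w f + pairing w' f := by
  simp [pairing, mul_add, Finsupp.sum, Finset.sum_add_distrib]

theorem pairing_mul_right (w : (Fin n →₀ ℕ) → ℍ[ℝ]) (h : ℍ[ℝ]) (f : QuatPoly n) :
    pairing (fun m => w m * h) f = pairing w f * h := by
  simp [pairing, Finsupp.sum, Finset.sum_mul, mul_assoc]

theorem pairing_single_mul (w : (Fin n →₀ ℕ) → ℍ[ℝ]) (k : Fin n →₀ ℕ) (b : ℍ[ℝ])
    (f : QuatPoly n) :
    pairing w (AddMonoidAlgebra.single k b * f) = b * pairing (fun m => w (k + m)) f := by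
  induction f using AddMonoidAlgebra.induction_linear with
  | zero => simp
  | add x y hx hy => simp [mul_add, hx, hy]
  | single m a => simp [AddMonoidAlgebra.single_mul_single, pairing_single, mul_assoc]

/-- The monomial `z^m` as a quaternion, for a complex point `z`. -/
noncomputable def complexMonomial (z : Fin n → ℂ) (m : Fin n →₀ ℕ) : ℍ[ℝ] :=
  ((∏ i, z i ^ m i : ℂ) : ℍ[ℝ])

/-- The functional `∑ a_m x^m ↦ ∑ a_m * c * z^m`; for `c ≠ 0` it is `f ↦ f(c z c⁻¹) * c`. -/
noncomputable def twistedEval (c : ℍ[ℝ]) (z : Fin n → ℂ) : QuatPoly n →+ ℍ[ℝ] :=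
  pairing fun m => c * complexMonomial z m

theorem evalAt_eq_pairing (q : Fin n → ℍ[ℝ]) (f : QuatPoly n) :
    evalAt q f = pairing (fun m => (List.ofFn fun u : Fin n => q u ^ m u).prod) f := rfl

theorem complexMonomial_add (z : Fin n → ℂ) (m k : Fin n →₀ ℕ) :
    complexMonomial z (m + k) = complexMonomial z m * complexMonomial z k := by
  simp [complexMonomial, pow_add, Finset.prod_mul_distrib, Quaternion.coeComplex_mul]

theorem coeComplex_eq_ofComplex (z : ℂ) : (z : ℍ[ℝ]) = Quaternion.ofComplex z := rfl

theorem conj_complexMonomial {c : ℍ[ℝ]} (hc : c ≠ 0) (z : Fin n → ℂ) (m : Fin n →₀ ℕ) :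
    (List.ofFn fun u : Fin n => (c * (z u : ℍ[ℝ]) * c⁻¹) ^ m u).prod
      = c * complexMonomial z m * c⁻¹ := by
  have h1 : complexMonomial z m = (List.ofFn fun u : Fin n => (z u : ℍ[ℝ]) ^ m u).prod := by
    rw [complexMonomial, ← List.prod_ofFn, coeComplex_eq_ofComplex, map_list_prod, List.map_ofFn]
    congr 2
    ext1 u
    exact map_pow Quaternion.ofComplex _ _
  let e : ℍ[ℝ] →* ℍ[ℝ] :=
    { toFun := fun x => c * x * c⁻¹
      map_one' := by simp [hc]
      map_mul' := fun x y => by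
        rw [show c * x * c⁻¹ * (c * y * c⁻¹) = c * x * (c⁻¹ * c) * (y * c⁻¹) by
          simp only [mul_assoc], inv_mul_cancel₀ hc]
        simp only [mul_assoc, mul_one] }
  change _ = e _
  rw [h1, map_list_prod, List.map_ofFn]
  congr 2
  ext1 u
  exact (map_pow e _ _).symm

theorem evalAt_conj {c : ℍ[ℝ]} (hc : c ≠ 0) (z : Fin n → ℂ) (f : QuatPoly n) :
    evalAt (fun u => c * (z u : ℍ[ℝ]) * c⁻¹) f = twistedEval c z f * c⁻¹ := by
  simp only [evalAt_eq_pairing, conj_complexMonomial hc, pairing_mul_right, twistedEval]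

theorem twistedEval_single_mul (c : ℍ[ℝ]) (z : Fin n → ℂ) (k : Fin n →₀ ℕ) (b : ℍ[ℝ])
    (f : QuatPoly n) :
    twistedEval c z (AddMonoidAlgebra.single k b * f) =
      b * twistedEval c z f * complexMonomial z k := by
  rw [twistedEval, pairing_single_mul, mul_assoc, ← pairing_mul_right]
  simp only [add_comm k, complexMonomial_add, mul_assoc]

theorem twistedEval_mul (c : ℍ[ℝ]) (z : Fin n → ℂ) (a b : QuatPoly n) :
    twistedEval c z (a * b) = twistedEval (twistedEval c z b) z a := by
  induction a using AddMonoidAlgebra.induction_linear with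
  | zero => simp
  | add x y hx hy => simp [add_mul, hx, hy]
  | single m a =>
    rw [twistedEval_single_mul]
    conv_rhs => rw [twistedEval, pairing_single]
    rw [mul_assoc]

theorem twistedEval_zero (z : Fin n → ℂ) (f : QuatPoly n) : twistedEval 0 z f = 0 := by
  simp [twistedEval, pairing]

/-- The left ideal of polynomials killed by `twistedEval c z`. -/
noncomputable def twistedIdeal (c : ℍ[ℝ]) (z : Fin n → ℂ) : Ideal (QuatPoly n) where
  carrier := {f | twistedEval c z f = 0}
  add_mem' {f g} hf hg := by
    simp only [Set.mem_ofPred_eq] at *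
    rw [map_add, hf, hg, add_zero]
  zero_mem' := map_zero _
  smul_mem' a f hf := by
    simp only [Set.mem_ofPred_eq, smul_eq_mul] at *
    rw [twistedEval_mul, hf, twistedEval_zero]

theorem mem_twistedIdeal {c : ℍ[ℝ]} {z : Fin n → ℂ} {f : QuatPoly n} :
    f ∈ twistedIdeal c z ↔ twistedEval c z f = 0 := Iff.rfl

/-- With `d` the value of `b`, the condition `P b ⊆ P` on the elements `x^k - c z^k c⁻¹` of `P` says
that `c⁻¹ d` commutes with every `z^k`. The value of `a * b` is then that of `a` times `c⁻¹ d`. -/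
theorem isCompletelyPrimeLeft_twistedIdeal {c : ℍ[ℝ]} (hc : c ≠ 0) (z : Fin n → ℂ) :
    IsCompletelyPrimeLeft (twistedIdeal c z) := by
  have hone : complexMonomial z 0 = 1 := by simp [complexMonomial]
  refine ⟨fun h => hc ?_, fun a b hab hb => ?_⟩
  · have : (1 : QuatPoly n) ∈ twistedIdeal c z := h ▸ Submodule.mem_top
    rw [mem_twistedIdeal, AddMonoidAlgebra.one_def, twistedEval, pairing_single, hone] at this
    simpa using this
  rw [mem_twistedIdeal, mem_twistedIdeal]
  by_contra! hne
  obtain ⟨ha, hd⟩ := hne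
  rw [mem_twistedIdeal, twistedEval_mul] at hab
  set d := twistedEval c z b with hd_def
  have hcm : ∀ k, d * complexMonomial z k = c * complexMonomial z k * c⁻¹ * d := by
    intro k
    have hmem : AddMonoidAlgebra.single k 1 -
        AddMonoidAlgebra.single 0 (c * complexMonomial z k * c⁻¹) ∈ twistedIdeal c z := by
      rw [mem_twistedIdeal, map_sub, twistedEval, pairing_single, pairing_single, hone]
      simp [mul_assoc, hc]
    have := hb _ hmem
    rw [mem_twistedIdeal, sub_mul, map_sub, twistedEval_single_mul, twistedEval_single_mul, hone,
      one_mul, mul_one, ← hd_def, sub_eq_zero] at this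
    exact this
  refine ha ?_
  have h2 : twistedEval d z a = twistedEval c z a * (c⁻¹ * d) := by
    rw [twistedEval, twistedEval, ← pairing_mul_right]
    simp only [hcm, mul_assoc]
  rw [h2] at hab
  exact (mul_eq_zero.1 hab).resolve_right (mul_ne_zero (inv_ne_zero hc) hd)

/-! ### Real components of quaternionic polynomials -/

/-- The inclusion of the polynomials with real coefficients. -/
noncomputable def ofReal : MvPolynomial (Fin n) ℝ →+* QuatPoly n :=
  AddMonoidAlgebra.mapRingHom (Fin n →₀ ℕ) (algebraMap ℝ ℍ[ℝ])

/-- The inclusion of the constants. -/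
noncomputable def const : ℍ[ℝ] →+* QuatPoly n := AddMonoidAlgebra.singleZeroRingHom

theorem const_apply (b : ℍ[ℝ]) : (const b : QuatPoly n) = AddMonoidAlgebra.single 0 b := rfl

theorem ofReal_single (m : Fin n →₀ ℕ) (r : ℝ) :
    ofReal (AddMonoidAlgebra.single m r) = AddMonoidAlgebra.single m (r : ℍ[ℝ]) := by
  simp [ofReal]

theorem ofReal_comm (s : MvPolynomial (Fin n) ℝ) (f : QuatPoly n) :
    ofReal s * f = f * ofReal s := by
  induction s using AddMonoidAlgebra.induction_linear with
  | zero => simp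
  | add x y hx hy => simp [add_mul, mul_add, hx, hy]
  | single m r =>
    induction f using AddMonoidAlgebra.induction_linear with
    | zero => simp
    | add x y hx hy => simp [add_mul, mul_add, hx, hy]
    | single k a =>
      rw [ofReal_single, AddMonoidAlgebra.single_mul_single, AddMonoidAlgebra.single_mul_single,
        add_comm, Quaternion.coe_commutes]

theorem twistedEval_ofReal_mul (c : ℍ[ℝ]) (z : Fin n → ℂ) (s : MvPolynomial (Fin n) ℝ)
    (f : QuatPoly n) :
    twistedEval c z (ofReal s * f) =
      twistedEval c z f * ((MvPolynomial.aeval z s : ℂ) : ℍ[ℝ]) := by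
  induction s using AddMonoidAlgebra.induction_linear with
  | zero => simp
  | add x y hx hy => simp [add_mul, mul_add, hx, hy, Quaternion.coeComplex_add]
  | single m r =>
    rw [ofReal_single, twistedEval_single_mul, Quaternion.coe_commutes, mul_assoc]
    congr 1
    change _ = ((MvPolynomial.aeval z (MvPolynomial.monomial m r) : ℂ) : ℍ[ℝ])
    rw [MvPolynomial.aeval_monomial, Quaternion.coeComplex_mul, complexMonomial,
      Finsupp.prod_fintype _ _ (by simp)]
    rfl

theorem twistedEval_const_mul (c : ℍ[ℝ]) (z : Fin n → ℂ) (b : ℍ[ℝ]) (f : QuatPoly n) :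
    twistedEval c z (const b * f) = b * twistedEval c z f := by
  rw [const_apply, twistedEval_single_mul]
  simp [complexMonomial]

theorem twistedEval_one (c : ℍ[ℝ]) (z : Fin n → ℂ) : twistedEval c z 1 = c := by
  rw [AddMonoidAlgebra.one_def, twistedEval, pairing_single]
  simp [complexMonomial]

/-- The quaternion unit `i`. -/
def unitI : ℍ[ℝ] := ⟨0, 1, 0, 0⟩

/-- The quaternion unit `j`. -/
def unitJ : ℍ[ℝ] := ⟨0, 0, 1, 0⟩

/-- The quaternion unit `k`. -/
def unitK : ℍ[ℝ] := ⟨0, 0, 0, 1⟩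

@[simp] theorem unitI_re : unitI.re = 0 := rfl
@[simp] theorem unitI_imI : unitI.imI = 1 := rfl
@[simp] theorem unitI_imJ : unitI.imJ = 0 := rfl
@[simp] theorem unitI_imK : unitI.imK = 0 := rfl
@[simp] theorem unitJ_re : unitJ.re = 0 := rfl
@[simp] theorem unitJ_imI : unitJ.imI = 0 := rfl
@[simp] theorem unitJ_imJ : unitJ.imJ = 1 := rfl
@[simp] theorem unitJ_imK : unitJ.imK = 0 := rfl
@[simp] theorem unitK_re : unitK.re = 0 := rfl
@[simp] theorem unitK_imI : unitK.imI = 0 := rfl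
@[simp] theorem unitK_imJ : unitK.imJ = 0 := rfl
@[simp] theorem unitK_imK : unitK.imK = 1 := rfl

/-- The polynomial with given real components. -/
noncomputable def ofComponents : (Fin 4 → MvPolynomial (Fin n) ℝ) →+ QuatPoly n where
  toFun s := ofReal (s 0) + const unitI * ofReal (s 1) + const unitJ * ofReal (s 2) +
    const unitK * ofReal (s 3)
  map_zero' := by simp
  map_add' s t := by
    simp only [Pi.add_apply, map_add, mul_add]
    abel

theorem ofComponents_apply (s : Fin 4 → MvPolynomial (Fin n) ℝ) :
    ofComponents s = ofReal (s 0) + const unitI * ofReal (s 1) + const unitJ * ofReal (s 2) +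
    const unitK * ofReal (s 3) := rfl

theorem ofComponents_surjective : Function.Surjective (ofComponents (n := n)) := by
  intro f
  induction f using AddMonoidAlgebra.induction_linear with
  | zero => exact ⟨0, map_zero _⟩
  | add x y hx hy =>
    obtain ⟨s, rfl⟩ := hx
    obtain ⟨t, rfl⟩ := hy
    exact ⟨s + t, map_add _ _ _⟩
  | single m a =>
    refine ⟨![AddMonoidAlgebra.single m a.re, AddMonoidAlgebra.single m a.imI,
      AddMonoidAlgebra.single m a.imJ, AddMonoidAlgebra.single m a.imK], ?_⟩
    rw [ofComponents_apply]
    simp only [Matrix.cons_val, ofReal_single, const_apply, AddMonoidAlgebra.single_mul_single,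
      zero_add, ← AddMonoidAlgebra.single_add]
    congr 1
    ext <;> simp

theorem ofComponents_smul (r : MvPolynomial (Fin n) ℝ) (s : Fin 4 → MvPolynomial (Fin n) ℝ) :
    ofComponents (r • s) = ofReal r * ofComponents s := by
  simp only [ofComponents_apply, Pi.smul_apply, smul_eq_mul, map_mul, mul_add]
  simp only [← mul_assoc, ofReal_comm r (const _)]

theorem twistedEval_ofComponents (c : ℍ[ℝ]) (z : Fin n → ℂ)
    (s : Fin 4 → MvPolynomial (Fin n) ℝ) :
    twistedEval c z (ofComponents s) =
      c * ((MvPolynomial.aeval z (s 0) : ℂ) : ℍ[ℝ]) +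
      unitI * (c * ((MvPolynomial.aeval z (s 1) : ℂ) : ℍ[ℝ])) +
      unitJ * (c * ((MvPolynomial.aeval z (s 2) : ℂ) : ℍ[ℝ])) +
      unitK * (c * ((MvPolynomial.aeval z (s 3) : ℂ) : ℍ[ℝ])) := by
  have h : ∀ r : MvPolynomial (Fin n) ℝ,
      twistedEval c z (ofReal r) = c * ((MvPolynomial.aeval z r : ℂ) : ℍ[ℝ]) := fun r => by
    have := twistedEval_ofReal_mul c z r 1
    rwa [mul_one, twistedEval_one] at this
  simp only [ofComponents_apply, map_add, twistedEval_const_mul, h]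

theorem const_unitI_mul (s : Fin 4 → MvPolynomial (Fin n) ℝ) :
    const unitI * ofComponents s = ofComponents ![-s 1, s 0, -s 3, s 2] := by
  have h1 : unitI * unitI = -1 := by ext <;> simp
  have h2 : unitI * unitJ = unitK := by ext <;> simp
  have h3 : unitI * unitK = -unitJ := by ext <;> simp
  simp only [ofComponents_apply, mul_add, ← mul_assoc, ← map_mul, h1, h2, h3, Matrix.cons_val,
    map_neg, map_one]
  noncomm_ring

theorem const_unitJ_mul (s : Fin 4 → MvPolynomial (Fin n) ℝ) :
    const unitJ * ofComponents s = ofComponents ![-s 2, s 3, s 0, -s 1] := by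
  have h1 : unitJ * unitI = -unitK := by ext <;> simp
  have h2 : unitJ * unitJ = -1 := by ext <;> simp
  have h3 : unitJ * unitK = unitI := by ext <;> simp
  simp only [ofComponents_apply, mul_add, ← mul_assoc, ← map_mul, h1, h2, h3, Matrix.cons_val,
    map_neg, map_one]
  noncomm_ring

theorem const_unitK_mul (s : Fin 4 → MvPolynomial (Fin n) ℝ) :
    const unitK * ofComponents s = ofComponents ![-s 3, -s 2, s 1, s 0] := by
  have h1 : unitK * unitI = unitJ := by ext <;> simp
  have h2 : unitK * unitJ = -unitI := by ext <;> simp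
  have h3 : unitK * unitK = -1 := by ext <;> simp
  simp only [ofComponents_apply, mul_add, ← mul_assoc, ← map_mul, h1, h2, h3, Matrix.cons_val,
    map_neg, map_one]
  noncomm_ring

/-! ### From linear forms on ℂ⁴ to twisted evaluations -/

/-- A complex linear form `(L t)` on `ℂ⁴`, turned into a quaternion. -/
noncomputable def dualQuaternion (L : Fin 4 → ℂ) : ℍ[ℝ] :=
  L 0 - unitI * L 1 - unitJ * L 2 - unitK * L 3

/-- The four entries on the right are `L` at `v`, `iv`, `jv`, `kv`. A form that kills a left ideal
kills all four. -/
theorem dualQuaternion_expand (L v : Fin 4 → ℂ) :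
    dualQuaternion L * v 0 + unitI * (dualQuaternion L * v 1) +
      unitJ * (dualQuaternion L * v 2) + unitK * (dualQuaternion L * v 3) =
    dualQuaternion ![∑ t, L t * v t, ∑ t, L t * ![-v 1, v 0, -v 3, v 2] t,
      ∑ t, L t * ![-v 2, v 3, v 0, -v 1] t, ∑ t, L t * ![-v 3, -v 2, v 1, v 0] t] := by
  simp only [dualQuaternion, Fin.sum_univ_four, Matrix.cons_val]
  ext <;> simp <;> ring

/-- `dualQuaternion` is not injective, since ℂ⁴ has real dimension 8; the conjugate form supplies
the missing equations. -/
theorem eq_zero_of_dualQuaternion_eq_zero {L : Fin 4 → ℂ} (h : dualQuaternion L = 0)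
    (h' : dualQuaternion (fun t => (starRingEnd ℂ) (L t)) = 0) : L 0 = 0 := by
  have h1 := congrArg (fun q : ℍ[ℝ] => q.re) h
  have h2 := congrArg (fun q : ℍ[ℝ] => q.imI) h
  have h3 := congrArg (fun q : ℍ[ℝ] => q.re) h'
  have h4 := congrArg (fun q : ℍ[ℝ] => q.imI) h'
  simp [dualQuaternion] at h1 h2 h3 h4
  apply Complex.ext <;> simp <;> linarith

theorem aeval_conj (z : Fin n → ℂ) (s : MvPolynomial (Fin n) ℝ) :
    MvPolynomial.aeval (fun i => (starRingEnd ℂ) (z i)) s =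
      (starRingEnd ℂ) (MvPolynomial.aeval z s) := by
  have := MvPolynomial.map_aeval (R := ℝ) z (starRingEnd ℂ) s
  rw [this, MvPolynomial.aeval_def, MvPolynomial.coe_eval₂Hom]
  congr 1
  ext
  simp

/-- A polynomial outside a completely prime left ideal is detected by a twisted evaluation that
kills the ideal. -/
theorem exists_twistedEval_ne_zero {P : Ideal (QuatPoly n)} (hP : IsCompletelyPrimeLeft P)
    {f : QuatPoly n} (hf : f ∉ P) :
    ∃ (c : ℍ[ℝ]) (z : Fin n → ℂ), (∀ g ∈ P, twistedEval c z g = 0) ∧ twistedEval c z f ≠ 0 := by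
  have hright : ∀ (s : MvPolynomial (Fin n) ℝ), ∀ g ∈ P, g * ofReal s ∈ P := fun s g hg => by
    rw [← ofReal_comm]
    exact P.mul_mem_left _ hg
  -- A central `b` satisfies `P b ⊆ P`, so complete primeness applies to it.
  have hmem : ∀ (s : MvPolynomial (Fin n) ℝ) (g : QuatPoly n),
      ofReal s * g ∈ P → ofReal s ∈ P ∨ g ∈ P := fun s g h => by
    rw [ofReal_comm] at h
    exact (hP.2 g (ofReal s) h (hright s)).symm
  let p : Ideal (MvPolynomial (Fin n) ℝ) := P.comap ofReal
  have hp : p.IsPrime := by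
    refine ⟨fun h => hP.1 ?_, fun {a b} hab => ?_⟩
    · have : (1 : MvPolynomial (Fin n) ℝ) ∈ p := h ▸ Submodule.mem_top
      rw [Ideal.mem_comap, map_one] at this
      exact (Ideal.eq_top_iff_one P).2 this
    · rw [Ideal.mem_comap, map_mul] at hab
      exact hmem _ _ hab
  obtain ⟨v, rfl⟩ := ofComponents_surjective f
  let N : AddSubgroup (Fin 4 → MvPolynomial (Fin n) ℝ) :=
    P.toAddSubgroup.comap ofComponents
  have hN : ∀ s, s ∈ N ↔ ofComponents s ∈ P := fun s => Iff.rfl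
  obtain ⟨l, hl, hlv⟩ := exists_linear_form_separating p N
    (fun s v hv => by
      rw [hN, ofComponents_smul]
      exact P.mul_mem_left _ hv)
    (fun v hv => by
      have hv' : ∀ i, ofReal (v i) ∈ P := hv
      rw [hN, ofComponents_apply]
      exact P.add_mem (P.add_mem (P.add_mem (hv' 0) (P.mul_mem_left _ (hv' 1)))
        (P.mul_mem_left _ (hv' 2))) (P.mul_mem_left _ (hv' 3)))
    (fun s v h => by
      rw [hN, ofComponents_smul] at h
      exact hmem _ _ h) v hf
  obtain ⟨z, hz, hzv⟩ := MvPolynomial.exists_complex_zero_of_notMem p _ hlv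
  have hkill : ∀ y : Fin n → ℂ, (∀ s ∈ p, MvPolynomial.aeval y s = 0) → ∀ g ∈ P,
      twistedEval (dualQuaternion fun t => MvPolynomial.aeval y (l t)) y g = 0 := by
    intro y hy g hg
    obtain ⟨s, rfl⟩ := ofComponents_surjective g
    have e0 := hy _ (hl s hg)
    have e1 := hy _ (hl ![-s 1, s 0, -s 3, s 2]
      (by rw [hN, ← const_unitI_mul]; exact P.mul_mem_left _ hg))
    have e2 := hy _ (hl ![-s 2, s 3, s 0, -s 1]
      (by rw [hN, ← const_unitJ_mul]; exact P.mul_mem_left _ hg))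
    have e3 := hy _ (hl ![-s 3, -s 2, s 1, s 0]
      (by rw [hN, ← const_unitK_mul]; exact P.mul_mem_left _ hg))
    rw [twistedEval_ofComponents]
    refine (dualQuaternion_expand _ fun t => MvPolynomial.aeval y (s t)).trans ?_
    simp only [Fin.sum_univ_four, Matrix.cons_val, map_add, map_mul, map_neg] at e0 e1 e2 e3
    simp only [Fin.sum_univ_four, Matrix.cons_val, e0, e1, e2, e3]
    simp [dualQuaternion]
  by_contra! hall
  refine hzv ?_
  -- Real coefficients make the conjugate of `z` a zero of `p` too.
  have a1 := hall _ z (hkill z hz)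
  have a2 := hall _ (fun i => (starRingEnd ℂ) (z i))
    (hkill _ fun s hs => by rw [aeval_conj, hz s hs, map_zero])
  rw [twistedEval_ofComponents] at a1 a2
  have b1 := (dualQuaternion_expand _ fun t => MvPolynomial.aeval z (v t)).symm.trans a1
  have b2 := (dualQuaternion_expand _ fun t =>
    MvPolynomial.aeval (fun i => (starRingEnd ℂ) (z i)) (v t)).symm.trans a2
  have := eq_zero_of_dualQuaternion_eq_zero b1 (by
    rw [← b2]
    congr 1
    ext1 t
    fin_cases t <;> simp [aeval_conj, Fin.sum_univ_four])
  simpa using this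

end QuatPoly

/-! ### Quaternions conjugate to complex numbers -/

/-- If `v` is the imaginary part of `q` and `r = |v|`, then `v² = (ri)² = -r²`, so `y = v + ri`
satisfies `v y = y (ri)`. -/
theorem Quaternion.exists_conj_coeComplex (q : ℍ[ℝ]) :
    ∃ (y : ℍ[ℝ]) (ζ : ℂ), y ≠ 0 ∧ q * y = y * (ζ : ℍ[ℝ]) := by
  by_cases h : q.imJ = 0 ∧ q.imK = 0
  · refine ⟨1, ⟨q.re, q.imI⟩, one_ne_zero, ?_⟩
    rw [mul_one, one_mul]
    ext <;> simp [h.1, h.2]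
  · set r := Real.sqrt (q.imI ^ 2 + q.imJ ^ 2 + q.imK ^ 2) with hr
    have hr2 : r * r = q.imI ^ 2 + q.imJ ^ 2 + q.imK ^ 2 := Real.mul_self_sqrt (by positivity)
    obtain ⟨y, y0, y1, y2, y3⟩ : ∃ y : ℍ[ℝ], y.re = 0 ∧ y.imI = q.imI + r ∧ y.imJ = q.imJ ∧
        y.imK = q.imK := ⟨⟨0, q.imI + r, q.imJ, q.imK⟩, rfl, rfl, rfl, rfl⟩
    refine ⟨y, ⟨q.re, r⟩, fun h0 => h ?_, ?_⟩
    · rw [← y2, ← y3, h0]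
      exact ⟨rfl, rfl⟩
    · ext <;> simp [y0, y1, y2, y3] <;> linarith

theorem Quaternion.mul_self_of_conj_coeComplex {q y : ℍ[ℝ]} {ζ : ℂ} (hy : y ≠ 0)
    (h : q * y = y * (ζ : ℍ[ℝ])) :
    q * q = ((2 * ζ.re : ℝ) : ℍ[ℝ]) * q - ((ζ.re * ζ.re + ζ.im * ζ.im : ℝ) : ℍ[ℝ]) := by
  have hζ : (ζ : ℍ[ℝ]) * ζ =
      ((2 * ζ.re : ℝ) : ℍ[ℝ]) * ζ - ((ζ.re * ζ.re + ζ.im * ζ.im : ℝ) : ℍ[ℝ]) := by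
    ext <;> simp <;> ring
  refine mul_right_cancel₀ hy ?_
  rw [mul_assoc, h, ← mul_assoc, h, mul_assoc, hζ, sub_mul, mul_assoc, h, mul_sub, ← mul_assoc,
    Quaternion.coe_commutes _ y, ← mul_assoc, Quaternion.coe_commutes _ y]

/-! ### Making the coordinates commute one at a time -/

namespace QuatPoly

variable {n : ℕ}

/-- The weight `c * (∏_{i < k} z_i ^ m_i) * h * (q_k ^ m_k * ⋯)`. -/
noncomputable def mixedWeight (q : Fin n → ℍ[ℝ]) (c : ℍ[ℝ]) (z : Fin n → ℂ) (k : ℕ) (h : ℍ[ℝ])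
    (m : Fin n →₀ ℕ) : ℍ[ℝ] :=
  c * ((∏ i : Fin n with i.val < k, z i ^ m i : ℂ) : ℍ[ℝ]) * h *
    ((List.ofFn fun u : Fin n => q u ^ m u).drop k).prod

theorem single_add_apply_of_ne {i j : Fin n} (h : i ≠ j) (m : Fin n →₀ ℕ) :
    (Finsupp.single i 1 + m : Fin n →₀ ℕ) j = m j := by
  simp [h]

theorem drop_ofFn_congr {q : Fin n → ℍ[ℝ]} {m m' : Fin n →₀ ℕ} {k : ℕ}
    (h : ∀ i : Fin n, k ≤ i.val → m i = m' i) :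
    (List.ofFn fun u : Fin n => q u ^ m u).drop k =
      (List.ofFn fun u : Fin n => q u ^ m' u).drop k := by
  refine List.ext_getElem (by simp) fun i h1 h2 => ?_
  simp only [List.getElem_drop, List.getElem_ofFn]
  rw [h _ (Nat.le_add_right _ _)]

theorem drop_ofFn_prod (q : Fin n → ℍ[ℝ]) (m : Fin n →₀ ℕ) (k : Fin n) :
    ((List.ofFn fun u : Fin n => q u ^ m u).drop k).prod =
      q k ^ m k * ((List.ofFn fun u : Fin n => q u ^ m u).drop (k + 1)).prod := by
  rw [List.drop_eq_getElem_cons (by simp), List.prod_cons]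
  simp

theorem mixedWeight_zero_one (q : Fin n → ℍ[ℝ]) (z : Fin n → ℂ) (m : Fin n →₀ ℕ) :
    mixedWeight q 1 z 0 1 m = (List.ofFn fun u : Fin n => q u ^ m u).prod := by
  simp [mixedWeight]

theorem mixedWeight_last (q : Fin n → ℍ[ℝ]) (c : ℍ[ℝ]) (z : Fin n → ℂ) (h : ℍ[ℝ])
    (m : Fin n →₀ ℕ) : mixedWeight q c z n h m = c * complexMonomial z m * h := by
  simp [mixedWeight, complexMonomial, List.drop_eq_nil_of_le]

theorem mixedWeight_shift_lt (q : Fin n → ℍ[ℝ]) (c : ℍ[ℝ]) (z : Fin n → ℂ) {k : ℕ} (h : ℍ[ℝ])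
    {i : Fin n} (hi : i.val < k) (m : Fin n →₀ ℕ) :
    mixedWeight q c z k h (Finsupp.single i 1 + m) = mixedWeight q c z k (z i * h) m := by
  have h1 : (∏ j : Fin n with j.val < k, z j ^ (Finsupp.single i 1 + m : Fin n →₀ ℕ) j) =
      (∏ j : Fin n with j.val < k, z j ^ m j) * z i := by
    simp only [Finsupp.add_apply, pow_add, Finset.prod_mul_distrib]
    rw [mul_comm]
    congr 1
    refine (Finset.prod_eq_single i (fun j _ hj => ?_) (by simp [hi])).trans (by simp)
    simp [hj]
  rw [mixedWeight, mixedWeight, h1, drop_ofFn_congr (m' := m) fun j hj =>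
    single_add_apply_of_ne (fun e => by subst e; omega) m,
    Quaternion.coeComplex_mul]
  simp only [mul_assoc]

theorem mixedWeight_shift_self (q : Fin n → ℍ[ℝ]) (c : ℍ[ℝ]) (z : Fin n → ℂ) (k : Fin n)
    (h : ℍ[ℝ]) (m : Fin n →₀ ℕ) :
    mixedWeight q c z (k : ℕ) h (Finsupp.single k 1 + m) = mixedWeight q c z k (h * q k) m := by
  have h1 : (∏ j : Fin n with j.val < (k : ℕ), z j ^ (Finsupp.single k 1 + m : Fin n →₀ ℕ) j) =
      ∏ j : Fin n with j.val < (k : ℕ), z j ^ m j := by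
    refine Finset.prod_congr rfl fun j hj => ?_
    rw [Finset.mem_filter] at hj
    rw [single_add_apply_of_ne (fun e => by subst e; omega) m]
  rw [mixedWeight, mixedWeight, h1, drop_ofFn_prod, drop_ofFn_prod,
    drop_ofFn_congr (m' := m) fun j hj =>
      single_add_apply_of_ne (fun e => by subst e; omega) m]
  simp [pow_add, mul_assoc]

/-- The relation lets `q k ^ m k` cross `h` and join the complex block as `ζ ^ m k`. -/
theorem mixedWeight_succ (q : Fin n → ℍ[ℝ]) (c : ℍ[ℝ]) (z : Fin n → ℂ) (k : Fin n) {h : ℍ[ℝ]}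
    {ζ : ℂ} (hζ : h * q k = ζ * h) :
    mixedWeight q c (Function.update z k ζ) (k + 1) h = mixedWeight q c z k h := by
  ext1 m
  have hpow : h * q k ^ m k = ((ζ ^ m k : ℂ) : ℍ[ℝ]) * h := by
    have := (show SemiconjBy h (q k) (ζ : ℍ[ℝ]) from hζ).pow_right (m k)
    rw [coeComplex_eq_ofComplex, map_pow]
    exact this
  have hset : (Finset.univ.filter fun i : Fin n => i.val < (k : ℕ) + 1) =
      insert k (Finset.univ.filter fun i : Fin n => i.val < (k : ℕ)) := by
    ext i
    simp only [Finset.mem_filter, Finset.mem_univ, true_and, Finset.mem_insert, Fin.ext_iff]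
    omega
  have hprod : (∏ i : Fin n with i.val < (k : ℕ) + 1, Function.update z k ζ i ^ m i) =
      (∏ i : Fin n with i.val < (k : ℕ), z i ^ m i) * ζ ^ m k := by
    rw [hset, Finset.prod_insert (by simp), mul_comm, Function.update_self]
    congr 1
    refine Finset.prod_congr rfl fun i hi => ?_
    rw [Finset.mem_filter] at hi
    rw [Function.update_of_ne fun e => by subst e; omega]
  rw [mixedWeight, mixedWeight, hprod, drop_ofFn_prod, Quaternion.coeComplex_mul]
  have hpow' : ∀ x : ℍ[ℝ], h * (q k ^ m k * x) = ((ζ ^ m k : ℂ) : ℍ[ℝ]) * (h * x) := fun x => by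
    rw [← mul_assoc, hpow, mul_assoc]
  simp only [mul_assoc, hpow']

theorem mixedWeight_eq_of_real (q : Fin n → ℍ[ℝ]) {c c' h h' : ℍ[ℝ]} {z : Fin n → ℂ} {k : ℕ}
    (hz : ∀ i : Fin n, i.val < k → (z i).im = 0) (he : c * h = c' * h') :
    mixedWeight q c z k h = mixedWeight q c' z k h' := by
  ext1 m
  have : ∃ r : ℝ, (∏ i : Fin n with i.val < k, z i ^ m i) = (r : ℂ) := by
    refine ⟨∏ i : Fin n with i.val < k, (z i).re ^ m i, ?_⟩
    push_cast
    refine Finset.prod_congr rfl fun i hi => ?_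
    rw [Finset.mem_filter] at hi
    congr 1
    exact Complex.ext (by simp) (by simp [hz i hi.2])
  obtain ⟨r, hr⟩ := this
  rw [mixedWeight, mixedWeight, hr, Quaternion.coeComplex_coe, ← Quaternion.coe_commutes,
    ← Quaternion.coe_commutes, mul_assoc _ c, mul_assoc _ c', he]

theorem pairing_mixedWeight_add (q : Fin n → ℍ[ℝ]) (c : ℍ[ℝ]) (z : Fin n → ℂ) (k : ℕ)
    (h h' : ℍ[ℝ]) (f : QuatPoly n) :
    pairing (mixedWeight q c z k (h + h')) f =
      pairing (mixedWeight q c z k h) f + pairing (mixedWeight q c z k h') f := by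
  rw [← pairing_add]
  congr 2
  ext1 m
  simp only [mixedWeight, mul_add, add_mul]

theorem pairing_mixedWeight_real_mul (q : Fin n → ℍ[ℝ]) (c : ℍ[ℝ]) (z : Fin n → ℂ) (k : ℕ)
    (r : ℝ) (h : ℍ[ℝ]) (f : QuatPoly n) :
    pairing (mixedWeight q c z k (r * h)) f = pairing (mixedWeight q c z k h) f * (r : ℍ[ℝ]) := by
  rw [← pairing_mul_right]
  congr 2
  ext1 m
  simp only [mixedWeight, mul_assoc]
  rw [Quaternion.coe_commutes]
  simp only [mul_assoc]

/-- The quaternions `h` for which the functional with weight `mixedWeight q c z k h` kills `I`. -/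
def killing (I : Ideal (QuatPoly n)) (q : Fin n → ℍ[ℝ]) (c : ℍ[ℝ]) (z : Fin n → ℂ) (k : ℕ) :
    Set ℍ[ℝ] :=
  {h | ∀ g ∈ I, pairing (mixedWeight q c z k h) g = 0}

variable {I : Ideal (QuatPoly n)} {q : Fin n → ℍ[ℝ]} {c : ℍ[ℝ]} {z : Fin n → ℂ}

theorem add_mem_killing {k : ℕ} {h h' : ℍ[ℝ]} (hh : h ∈ killing I q c z k)
    (hh' : h' ∈ killing I q c z k) : h + h' ∈ killing I q c z k := fun g hg => by
  rw [pairing_mixedWeight_add, hh g hg, hh' g hg, add_zero]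

theorem real_mul_mem_killing {k : ℕ} {h : ℍ[ℝ]} (r : ℝ) (hh : h ∈ killing I q c z k) :
    (r : ℍ[ℝ]) * h ∈ killing I q c z k := fun g hg => by
  rw [pairing_mixedWeight_real_mul, hh g hg, zero_mul]

theorem mul_coord_mem_killing {k : Fin n} {h : ℍ[ℝ]} (hh : h ∈ killing I q c z k) :
    h * q k ∈ killing I q c z k := fun g hg => by
  have := hh _ (I.mul_mem_left (AddMonoidAlgebra.single (Finsupp.single k 1) 1) hg)
  rw [pairing_single_mul, one_mul] at this
  simpa only [mixedWeight_shift_self] using this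

theorem complex_mul_mem_killing {k : ℕ} {i : Fin n} (hi : i.val < k) (him : (z i).im ≠ 0)
    {h : ℍ[ℝ]} (w : ℂ) (hh : h ∈ killing I q c z k) : (w : ℍ[ℝ]) * h ∈ killing I q c z k := by
  have h1 : (z i : ℍ[ℝ]) * h ∈ killing I q c z k := fun g hg => by
    have := hh _ (I.mul_mem_left (AddMonoidAlgebra.single (Finsupp.single i 1) 1) hg)
    rw [pairing_single_mul, one_mul] at this
    simpa only [mixedWeight_shift_lt q c z h hi] using this
  -- As `z i` is not real, `w` is a real combination of `z i` and 1.
  have h2 := add_mem_killing (real_mul_mem_killing (w.im / (z i).im) h1)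
    (real_mul_mem_killing (w.re - w.im / (z i).im * (z i).re) hh)
  rw [← mul_assoc, ← add_mul] at h2
  generalize hr : w.im / (z i).im = r at h2
  have hr' : w.im = r * (z i).im := by rw [← hr, div_mul_cancel₀ _ him]
  convert h2 using 2
  ext <;> simp [hr']

/-- If every twisted evaluation that kills `I` kills `f`, then so does every mixed evaluation. -/
theorem pairing_mixedWeight_eq_zero {f : QuatPoly n}
    (hf : ∀ (c : ℍ[ℝ]) (z : Fin n → ℂ), (∀ g ∈ I, twistedEval c z g = 0) → twistedEval c z f = 0)
    (d : ℕ) : ∀ (k : ℕ), k + d = n → ∀ (c : ℍ[ℝ]) (z : Fin n → ℂ), ∀ h ∈ killing I q c z k,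
      pairing (mixedWeight q c z k h) f = 0 := by
  induction d with
  | zero =>
    intro k hk c z h hh
    rw [Nat.add_zero] at hk
    subst hk
    have hw : mixedWeight q c z k h = fun m => c * complexMonomial z m * h :=
      funext fun m => mixedWeight_last q c z h m
    have hval : ∀ g : QuatPoly k, pairing (mixedWeight q c z k h) g = twistedEval c z g * h :=
      fun g => by rw [hw, pairing_mul_right, twistedEval]
    rw [hval]
    by_cases h0 : h = 0
    · rw [h0, mul_zero]
    · rw [hf c z fun g hg => ?_, zero_mul]
      have := hh g hg
      rw [hval] at this
      exact (mul_eq_zero.1 this).resolve_right h0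
  | succ d ih =>
    intro k hk c z h hh
    let K : Fin n := ⟨k, by omega⟩
    have advance : ∀ (c h : ℍ[ℝ]) (ζ : ℂ), h * q K = ζ * h → h ∈ killing I q c z k →
        pairing (mixedWeight q c z k h) f = 0 := by
      intro c h ζ hζ hh
      have hw := mixedWeight_succ q c z K hζ
      have := ih (k + 1) (by omega) c (Function.update z K ζ) h fun g hg => by
        rw [hw]; exact hh g hg
      rwa [hw] at this
    obtain ⟨y, ζ, hy, hyζ⟩ := Quaternion.exists_conj_coeComplex (q K)
    by_cases hz : ∀ i : Fin n, i.val < k → (z i).im = 0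
    -- A real block is central, so only `c * h` matters and `h` can be replaced by `y⁻¹`, for which
    -- `y⁻¹ * q K = ζ * y⁻¹`.
    · have hw := mixedWeight_eq_of_real q (c := c) (h := h) (c' := c * h * y) (h' := y⁻¹) hz
        (by rw [mul_assoc _ y, mul_inv_cancel₀ hy, mul_one])
      rw [hw]
      refine advance _ _ ζ ?_ fun g hg => by rw [← hw]; exact hh g hg
      refine mul_right_cancel₀ hy ?_
      rw [mul_assoc, hyζ, ← mul_assoc, inv_mul_cancel₀ hy, one_mul, mul_assoc,
        inv_mul_cancel₀ hy, mul_one]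
    · push Not at hz
      obtain ⟨i, hi, him⟩ := hz
      by_cases hζ : ζ.im = 0
      · have hre : (ζ : ℍ[ℝ]) = ((ζ.re : ℝ) : ℍ[ℝ]) := by ext <;> simp [hζ]
        have hq : q K = ((ζ.re : ℝ) : ℍ[ℝ]) := by
          refine mul_right_cancel₀ hy ?_
          rw [hyζ, hre, Quaternion.coe_commutes]
        exact advance c h ζ (by rw [hq, hre, Quaternion.coe_commutes]) hh
      · -- split `h` into eigenvectors of the right multiplication by `q K`
        have hsq := Quaternion.mul_self_of_conj_coeComplex hy hyζ
        -- ℂ acts on the killing set from the left and commutes with `T`, right multiplication by `q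
        -- K`. Since `(T - a)(T - b) = 0`, the vector `(T - b) h` has eigenvalue `a`.
        have eigen : ∀ a b : ℂ, a + b = ((2 * ζ.re : ℝ) : ℂ) →
            a * b = ((ζ.re * ζ.re + ζ.im * ζ.im : ℝ) : ℂ) → ∀ u : ℂ,
            pairing (mixedWeight q c z k ((u : ℍ[ℝ]) * (h * q K + ((-b : ℂ) : ℍ[ℝ]) * h))) f
              = 0 := by
          intro a b hab hab' u
          refine advance c _ a ?_ (complex_mul_mem_killing hi him u
            (add_mem_killing (mul_coord_mem_killing (k := K) hh)
              (complex_mul_mem_killing hi him (-b) hh)))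
          have e1 : (h * q K + ((-b : ℂ) : ℍ[ℝ]) * h) * q K =
              (a : ℍ[ℝ]) * (h * q K + ((-b : ℂ) : ℍ[ℝ]) * h) := by
            rw [add_mul, mul_assoc, hsq, mul_sub, ← mul_assoc, ← Quaternion.coe_commutes,
              ← Quaternion.coe_commutes, ← Quaternion.coeComplex_coe, ← Quaternion.coeComplex_coe,
              ← hab, ← hab']
            simp only [coeComplex_eq_ofComplex, map_add, map_mul, map_neg]
            noncomm_ring
          have e2 : (u : ℍ[ℝ]) * (a : ℍ[ℝ]) = (a : ℍ[ℝ]) * (u : ℍ[ℝ]) := by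
            rw [← Quaternion.coeComplex_mul, mul_comm, Quaternion.coeComplex_mul]
          rw [mul_assoc, e1, ← mul_assoc, e2, mul_assoc]
        let ζ' := (starRingEnd ℂ) ζ
        have hs : ζ + ζ' = ((2 * ζ.re : ℝ) : ℂ) := by apply Complex.ext <;> simp [ζ'] ; ring
        have hp : ζ * ζ' = ((ζ.re * ζ.re + ζ.im * ζ.im : ℝ) : ℂ) := by
          apply Complex.ext <;> simp [ζ'] ; ring
        have hne : ζ - ζ' ≠ 0 := fun e => hζ (by
          have := congrArg Complex.im e
          simp [ζ'] at this
          linarith)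
        have h1 := eigen ζ ζ' hs hp (ζ - ζ')⁻¹
        have h2 := eigen ζ' ζ (by rw [add_comm, hs]) (by rw [mul_comm, hp]) (-(ζ - ζ')⁻¹)
        -- This is `1 = ((T - ζ') - (T - ζ)) / (ζ - ζ')` applied to `h`.
        have hsplit : h = (((ζ - ζ')⁻¹ : ℂ) : ℍ[ℝ]) * (h * q K + ((-ζ' : ℂ) : ℍ[ℝ]) * h) +
            ((-(ζ - ζ')⁻¹ : ℂ) : ℍ[ℝ]) * (h * q K + ((-ζ : ℂ) : ℍ[ℝ]) * h) := by
          have hinv : (((ζ - ζ')⁻¹ : ℂ) : ℍ[ℝ]) * ((ζ : ℍ[ℝ]) - (ζ' : ℍ[ℝ])) = 1 := by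
            simp only [coeComplex_eq_ofComplex, ← map_sub, ← map_mul, inv_mul_cancel₀ hne, map_one]
          calc h = (((ζ - ζ')⁻¹ : ℂ) : ℍ[ℝ]) * ((ζ : ℍ[ℝ]) - (ζ' : ℍ[ℝ])) * h := by
                rw [hinv, one_mul]
            _ = _ := by
              generalize (ζ - ζ')⁻¹ = t
              simp only [coeComplex_eq_ofComplex, map_neg]
              noncomm_ring
        rw [hsplit, pairing_mixedWeight_add, h1, h2, add_zero]

end QuatPoly

open QuatPoly in
theorem mainTheorem2 (n : ℕ) (I : Ideal (QuatPoly n)) :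
    QuatPoly.vanishingSet (QuatPoly.zeroLocus (I : Set (QuatPoly n))) =
      (leftRadical I : Set (QuatPoly n)) := by
  ext f
  rw [SetLike.mem_coe, leftRadical, Submodule.mem_sInf]
  constructor
  · rintro hf P ⟨hP, hIP⟩
    by_contra hfP
    obtain ⟨c, z, hkill, hne⟩ := exists_twistedEval_ne_zero hP hfP
    have hc : c ≠ 0 := by
      rintro rfl
      exact hne (twistedEval_zero z f)
    have h0 := hf (fun u => c * (z u : ℍ[ℝ]) * c⁻¹) fun g hg => by
      rw [evalAt_conj hc, hkill g (hIP hg), zero_mul]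
    rw [evalAt_conj hc] at h0
    exact hne ((mul_eq_zero.1 h0).resolve_right (inv_ne_zero hc))
  · intro hf q hq
    have hf' : ∀ (c : ℍ[ℝ]) (z : Fin n → ℂ), (∀ g ∈ I, twistedEval c z g = 0) →
        twistedEval c z f = 0 := by
      intro c z hkill
      by_cases hc : c = 0
      · rw [hc, twistedEval_zero]
      · exact hf (twistedIdeal c z) ⟨isCompletelyPrimeLeft_twistedIdeal hc z, hkill⟩
    have hw : mixedWeight q 1 0 0 1 =
        fun m => (List.ofFn fun u : Fin n => q u ^ m u).prod :=
      funext (mixedWeight_zero_one q 0)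
    -- At `k = 0` the complex block is empty, so `z = 0` is an arbitrary choice.
    have := pairing_mixedWeight_eq_zero (q := q) hf' n 0 (zero_add n) 1 0 1 fun g hg => by
      rw [hw, ← evalAt_eq_pairing]
      exact hq g hg
    rwa [hw, ← evalAt_eq_pairing] at this
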